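/- Distances in the plane are Manhattan distances $d_M$. A configuration $(R,P)$ consists of a rectangle $R=[0,\rho]\times[0,1]$ and a finite set $P\subseteq R$. The Voronoi cell of $p\in P$ is $V(p)=\{z\in R: d_M(z,p)<d_M(z,q)\text{ for all }q\in P\setminus\{p\}\}$. The configuration is *balanced* if all cells $V(p)$, $p\in P$, have the same area and every $p\in P$ minimizes the average Manhattan distance to the points of $V(p)$. A *subconfiguration* is a subset $Q\subseteq P$ for which $\bigcup_{p\in Q}V(p)$ is, up to closure, a (nondegenerate axis-parallel) rectangle $R_Q$; it is *atomic* if $Q$ cannot be partitioned into two or more subconfigurations. Two disjoint subconfigurations $Q,Q'$ are *directly adjacent* if $R_Q\cap R_{Q'}$ contains more than one point. The configuration is *non-repetitive* if there are no two directly adjacent atomic subconfigurations $(R_Q,Q)$, $(R_{Q'},Q')$ that are translates of each other (so a block and its mirror image count as different unless they are translates). Let $\mathcal R_3$ be the configuration with $\rho=\frac{36}{49}$ and points $(\frac{12}{49},\frac{3}{14}),(\frac{12}{49},\frac{11}{14}),(\frac{30}{49},\frac12)$, let $\mathcal R_3'$ be its mirror image under $x\mapsto\frac{36}{49}-x$,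 and let $\mathcal R_5$ be the configuration with $\rho=\frac{60}{49}$ and points $(\frac{12}{49},\frac{3}{14}),(\frac{12}{49},\frac{11}{14}),(\frac{30}{49},\frac12),(\frac{48}{49},\frac{3}{14}),(\frac{48}{49},\frac{11}{14})$. For a finite 0-1 string $S=s_1\dots s_m$, let $\mathcal C(S)$ be the configuration obtained by placing side by side, from left to right, for $i=1,\dots,m$ the blocks $\mathcal R_3,\mathcal R_3'$, followed by a block $\mathcal R_5$ if $s_i=1$. (The empty string yields the configuration without points and with $\rho=0$.) **Theorem.** The map $S\mapsto\mathcal C(S)$ is injective on the set of all finite 0-1 strings. For every finite 0-1 string $S$, the configuration $\mathcal C(S)$ is balanced and non-repetitive, and no Voronoi cell of $\mathcal C(S)$ is, up to closure, a rectangle. If $S$ is nonempty, then $\mathcal C(S)$ has at least one point and its rectangle has width $\rho\ge1$. -/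

import Mathlib

open MeasureTheory

noncomputable section

namespace ManhattanVoronoi

/-- The Manhattan distance in the plane. -/
def dM (p q : ℝ × ℝ) : ℝ := |p.1 - q.1| + |p.2 - q.2|

/-- A finite point set together with a rectangle of height `1`, placed with its lower left
corner at the origin. -/
structure Config where
  /-- the width of the rectangle -/
  width : ℝ
  /-- the point set -/
  points : Finset (ℝ × ℝ)

/-- A (nondegenerate, closed, axis-parallel) rectangle. -/
def IsRectangle (S : Set (ℝ × ℝ)) : Prop :=
  ∃ a b c d : ℝ, a < b ∧ c < d ∧ S = Set.Icc a b ×ˢ Set.Icc c d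

namespace Config

/-- The rectangle `R` of a configuration. -/
def rect (C : Config) : Set (ℝ × ℝ) := Set.Icc 0 C.width ×ˢ Set.Icc 0 1

/-- The Voronoi cell of `p`: the points of `R` that are strictly closer to `p` than to every
other point of the configuration. -/
def cell (C : Config) (p : ℝ × ℝ) : Set (ℝ × ℝ) :=
  {z | z ∈ C.rect ∧ ∀ q ∈ C.points, q ≠ p → dM z p < dM z q}

/-- Fairness (all Voronoi cells have the same area) and local optimality (each point minimizes
the average Manhattan distance to the points of its own Voronoi cell). -/
def Balanced (C : Config) : Prop :=
  (∀ p ∈ C.points, ∀ q ∈ C.points, volume (C.cell p) = volume (C.cell q)) ∧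
  (∀ p ∈ C.points, ∀ q : ℝ × ℝ,
    (⨍ z in C.cell p, dM z p) ≤ ⨍ z in C.cell p, dM z q)

/-- No Voronoi cell is a rectangle. Cells do not contain their bisectors, so shapes are compared
up to closure. -/
def NoRectangularCell (C : Config) : Prop :=
  ∀ p ∈ C.points, ¬ IsRectangle (closure (C.cell p))

/-- The region occupied by a set `Q` of points: the union of their Voronoi cells, completed by
the limit points of this union. -/
def region (C : Config) (Q : Finset (ℝ × ℝ)) : Set (ℝ × ℝ) :=
  closure (⋃ p ∈ Q, C.cell p)

/-- A subconfiguration: a set of points of `C` whose Voronoi cells together form a rectangle.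
(It is nonempty, since the region of the empty set is empty.) -/
def IsSubconfig (C : Config) (Q : Finset (ℝ × ℝ)) : Prop :=
  Q ⊆ C.points ∧ IsRectangle (C.region Q)

/-- An atomic subconfiguration: it cannot be decomposed into two or more subconfigurations. -/
def IsAtomic (C : Config) (Q : Finset (ℝ × ℝ)) : Prop :=
  C.IsSubconfig Q ∧
    ∀ π : Finpartition Q, (∀ T ∈ π.parts, C.IsSubconfig T) → π.parts = {Q}

/-- Two subconfigurations are directly adjacent: they have no common point, and their
rectangles meet in more than a single corner. -/
def DirectlyAdjacent (C : Config) (Q₁ Q₂ : Finset (ℝ × ℝ)) : Prop :=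
  Disjoint Q₁ Q₂ ∧ (C.region Q₁ ∩ C.region Q₂).Nontrivial

/-- Two subconfigurations are copies of each other: a translation takes the points and the
rectangle of the first to those of the second. A block and its mirror image are thus
different, unless the block is symmetric. -/
def IsCopy (C : Config) (Q₁ Q₂ : Finset (ℝ × ℝ)) : Prop :=
  ∃ v : ℝ × ℝ, Q₂ = Q₁.image (fun p => p + v) ∧
    C.region Q₂ = (fun z => z + v) '' C.region Q₁

/-- Non-repetitive: no two directly adjacent atomic subconfigurations are copies of each
other. -/
def NonRepetitive (C : Config) : Prop :=
  ∀ Q₁ Q₂ : Finset (ℝ × ℝ), C.IsAtomic Q₁ → C.IsAtomic Q₂ → C.DirectlyAdjacent Q₁ Q₂ →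
    ¬ C.IsCopy Q₁ Q₂

/-- The configuration without points in the rectangle of width `0`. -/
def empty : Config := ⟨0, ∅⟩

/-- Place the rectangle of `B` immediately to the right of the rectangle of `A`. -/
def append (A B : Config) : Config :=
  ⟨A.width + B.width, A.points ∪ B.points.image (fun p => (A.width + p.1, p.2))⟩

/-- Place the members of a list of configurations side by side, from left to right. -/
def concat (L : List Config) : Config := L.foldr append empty

/-- The mirror image, exchanging left and right. -/
def reflect (A : Config) : Config :=
  ⟨A.width, A.points.image (fun p => (A.width - p.1, p.2))⟩

end Config

/-- The block `R₃`, with three points in a rectangle of height `1` and width `36 / 49`. -/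
def R3 : Config where
  width := 36 / 49
  points := {(12 / 49, 3 / 14), (12 / 49, 11 / 14), (30 / 49, 1 / 2)}

/-- The block `R₅`, with five points in a rectangle of height `1` and width `60 / 49`. -/
def R5 : Config where
  width := 60 / 49
  points := {(12 / 49, 3 / 14), (12 / 49, 11 / 14), (30 / 49, 1 / 2),
    (48 / 49, 3 / 14), (48 / 49, 11 / 14)}

/-- The block sequence of a 0-1 string (`true` is `1`): one pair of `R₃` and its mirror image
for each position, followed by a block `R₅` if the position holds a `1`. -/
def blocks (S : List Bool) : List Config :=
  S.flatMap fun b => if b then [R3, R3.reflect, R5] else [R3, R3.reflect]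

/-- The configuration that represents a 0-1 string. -/
def encode (S : List Bool) : Config := Config.concat (blocks S)

end ManhattanVoronoi

end

/-! Inside a block the Voronoi diagram is explicit. The central point (height 1/2) is separated from
each pair of corner points (heights 3/14 and 11/14) by the graph of `profile` or its mirror image,
and the two points of a pair are separated by the line y = 1/2. Each cell thus lies between two
graphs over an interval of second coordinates.

Balance: Manhattan distance splits into coordinates, so a point is optimal as soon as each of its
coordinates is a median over its cell (`integral_abs_sub_le_of_median`). The vertical and the
horizontal line through each point halve its cell into areas 6/49 (`bisected_of_mem_sites`), which
gives fairness as well.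

Gluing: consecutive blocks have mirror-image points next to their common boundary, so that line is a
bisector. Every interior point of a block is closer to some point of its own block than to any given
foreign point (`exists_dM_lt_right`, `exists_dM_lt_left`), and the cells stay those of the isolated
blocks.

Rigidity: the central cell of a block interlocks with each corner cell. A rectangle containing one
of the two open cells meets the other (`exists_linked`), so a subconfiguration is a union of whole
blocks. Hence no cell is a rectangle, atomic subconfigurations are single blocks, and adjacent ones
differ in kind, so they are not translates.

Injectivity: equal leading blocks can be cancelled, and a leading `R5` is recognised by a point at
(48/49, 3/14). -/

noncomputable section

namespace ManhattanVoronoi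

open Set

/-! ### Regions between two graphs: closure, compactness, area -/

/-- The closed region between the graphs of two functions of the second coordinate. -/
def closedStrip (c d : ℝ) (l r : ℝ → ℝ) : Set (ℝ × ℝ) :=
  {z | (c ≤ z.2 ∧ z.2 ≤ d) ∧ l z.2 ≤ z.1 ∧ z.1 ≤ r z.2}

/-- The open region between the graphs of two functions of the second coordinate. -/
def openStrip (c d : ℝ) (l r : ℝ → ℝ) : Set (ℝ × ℝ) :=
  {z | (c < z.2 ∧ z.2 < d) ∧ l z.2 < z.1 ∧ z.1 < r z.2}

section Strip

variable {c d : ℝ} {l r : ℝ → ℝ}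

theorem openStrip_subset_closedStrip : openStrip c d l r ⊆ closedStrip c d l r :=
  fun _ h => ⟨⟨h.1.1.le, h.1.2.le⟩, h.2.1.le, h.2.2.le⟩

/-- The map that straightens a strip. -/
def stripMap (l r : ℝ → ℝ) (w : ℝ × ℝ) : ℝ × ℝ := (l w.2 + w.1 * (r w.2 - l w.2), w.2)

theorem continuous_stripMap (hl : Continuous l) (hr : Continuous r) :
    Continuous (stripMap l r) := by
  unfold stripMap
  fun_prop

theorem closedStrip_eq_image (h : ∀ y, c ≤ y → y ≤ d → l y < r y) :
    closedStrip c d l r = stripMap l r '' (Icc 0 1 ×ˢ Icc c d) := by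
  ext ⟨x, y⟩
  constructor
  · rintro ⟨⟨h1, h2⟩, h3, h4⟩
    have hp := sub_pos.2 (h y h1 h2)
    refine ⟨((x - l y) / (r y - l y), y), ⟨⟨?_, ?_⟩, h1, h2⟩, ?_⟩
    · exact div_nonneg (sub_nonneg.2 h3) hp.le
    · rw [div_le_one hp]
      simpa using h4
    · simp only [stripMap, Prod.mk.injEq, and_true]
      field_simp
      ring
  · rintro ⟨⟨t, u⟩, ⟨⟨h1, h2⟩, h3, h4⟩, he⟩
    simp only [stripMap, Prod.mk.injEq] at he h1 h2 h3 h4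
    obtain ⟨rfl, rfl⟩ := he
    have hp := sub_pos.2 (h u h3 h4)
    refine ⟨⟨h3, h4⟩, ?_, ?_⟩ <;> simp only <;> nlinarith

theorem isCompact_closedStrip (hl : Continuous l) (hr : Continuous r)
    (h : ∀ y, c ≤ y → y ≤ d → l y < r y) : IsCompact (closedStrip c d l r) := by
  rw [closedStrip_eq_image h]
  exact (isCompact_Icc.prod isCompact_Icc).image (continuous_stripMap hl hr)

/-- Straightening turns the claim into the fact that a closed box is the closure of its interior;
the continuous image of a closure lies in the closure of the image. -/
theorem closedStrip_subset_closure_openStrip (hcd : c < d) (hl : Continuous l)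
    (hr : Continuous r) (h : ∀ y, c ≤ y → y ≤ d → l y < r y) :
    closedStrip c d l r ⊆ closure (openStrip c d l r) := by
  have hc : Icc (0 : ℝ) 1 ×ˢ Icc c d = closure (Ioo (0 : ℝ) 1 ×ˢ Ioo c d) := by
    rw [closure_prod_eq, closure_Ioo zero_ne_one, closure_Ioo hcd.ne]
  rw [closedStrip_eq_image h, hc]
  refine (image_closure_subset_closure_image (continuous_stripMap hl hr)).trans
    (closure_mono ?_)
  rintro _ ⟨⟨t, u⟩, ⟨⟨h1, h2⟩, h3, h4⟩, rfl⟩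
  have hp := sub_pos.2 (h u h3.le h4.le)
  refine ⟨⟨h3, h4⟩, ?_, ?_⟩ <;> simp only [stripMap] at * <;> nlinarith

theorem measurableSet_closedStrip (hl : Continuous l) (hr : Continuous r) :
    MeasurableSet (closedStrip c d l r) := by
  apply IsClosed.measurableSet
  exact ((isClosed_le continuous_const continuous_snd).inter
    (isClosed_le continuous_snd continuous_const)).inter
    ((isClosed_le (hl.comp continuous_snd) continuous_fst).inter
      (isClosed_le continuous_fst (hr.comp continuous_snd)))

theorem measurableSet_openStrip (hl : Continuous l) (hr : Continuous r) :
    MeasurableSet (openStrip c d l r) := by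
  apply IsOpen.measurableSet
  exact ((isOpen_lt continuous_const continuous_snd).inter
    (isOpen_lt continuous_snd continuous_const)).inter
    ((isOpen_lt (hl.comp continuous_snd) continuous_fst).inter
      (isOpen_lt continuous_fst (hr.comp continuous_snd)))

theorem volume_closedStrip_eq_lintegral (hl : Continuous l) (hr : Continuous r) :
    volume (closedStrip c d l r) = ∫⁻ y in Icc c d, ENNReal.ofReal (r y - l y) := by
  rw [Measure.volume_eq_prod, Measure.prod_apply_symm (measurableSet_closedStrip hl hr),
    ← lintegral_indicator measurableSet_Icc]
  congr 1
  ext y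
  by_cases hy : y ∈ Icc c d
  · rw [indicator_of_mem hy, ← Real.volume_Icc]
    congr 1
    ext x
    exact ⟨fun h => h.2, fun h => ⟨hy, h⟩⟩
  · rw [indicator_of_notMem hy]
    refine (congrArg _ (eq_empty_of_forall_notMem fun x h => hy ?_)).trans measure_empty
    exact h.1

/-- The integral is taken over the closed interval, to be literally the one for the closed strip:
the bounding graphs are then seen to be null. -/
theorem volume_openStrip_eq_lintegral (hl : Continuous l) (hr : Continuous r) :
    volume (openStrip c d l r) = ∫⁻ y in Icc c d, ENNReal.ofReal (r y - l y) := by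
  rw [Measure.volume_eq_prod, Measure.prod_apply_symm (measurableSet_openStrip hl hr),
    setLIntegral_congr Ioo_ae_eq_Icc.symm, ← lintegral_indicator measurableSet_Ioo]
  congr 1
  ext y
  by_cases hy : y ∈ Ioo c d
  · rw [indicator_of_mem hy, ← Real.volume_Ioo]
    congr 1
    ext x
    exact ⟨fun h => h.2, fun h => ⟨hy, h⟩⟩
  · rw [indicator_of_notMem hy]
    refine (congrArg _ (eq_empty_of_forall_notMem fun x h => hy ?_)).trans measure_empty
    exact h.1

theorem volume_closedStrip (hl : Continuous l) (hr : Continuous r) (hcd : c ≤ d)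
    (h : ∀ y, c ≤ y → y ≤ d → l y ≤ r y) :
    volume (closedStrip c d l r) = ENNReal.ofReal (∫ y in c..d, (r y - l y)) := by
  rw [volume_closedStrip_eq_lintegral hl hr, intervalIntegral.integral_of_le hcd,
    ← integral_Icc_eq_integral_Ioc, ofReal_integral_eq_lintegral_ofReal]
  · exact (hr.sub hl).continuousOn.integrableOn_Icc
  · filter_upwards [ae_restrict_mem measurableSet_Icc] with y hy
    exact sub_nonneg.2 (h y hy.1 hy.2)

theorem openStrip_ae_eq_closedStrip (hl : Continuous l) (hr : Continuous r)
    (h : ∀ y, c ≤ y → y ≤ d → l y < r y) :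
    openStrip c d l r =ᵐ[volume] closedStrip c d l r := by
  refine ae_eq_of_subset_of_measure_ge openStrip_subset_closedStrip ?_
    (measurableSet_openStrip hl hr).nullMeasurableSet
    (isCompact_closedStrip hl hr h).measure_lt_top.ne
  rw [volume_closedStrip_eq_lintegral hl hr, volume_openStrip_eq_lintegral hl hr]

end Strip

/-! ### Medians and mean absolute deviation -/

/-- A median of a function minimizes the mean absolute deviation. -/
theorem integral_abs_sub_le_of_median {α : Type*} [MeasurableSpace α] {μ : Measure α}
    [IsFiniteMeasure μ] {g : α → ℝ} (hg : Integrable g μ) (hm : Measurable g) {m : ℝ}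
    (h : μ {z | g z ≤ m} = μ {z | m ≤ g z}) (c : ℝ) :
    ∫ z, |g z - m| ∂μ ≤ ∫ z, |g z - c| ∂μ := by
  have hA : MeasurableSet {z | g z ≤ m} := measurableSet_le hm measurable_const
  have hB : MeasurableSet {z | m ≤ g z} := measurableSet_le measurable_const hm
  have hi : ∀ c : ℝ, Integrable (fun z => |g z - c|) μ :=
    fun c => (hg.sub (integrable_const c)).abs
  have hIA : Integrable ({z | g z ≤ m}.indicator fun _ => c - m) μ :=
    (integrable_const _).indicator hA
  have hIB : Integrable ({z | m ≤ g z}.indicator fun _ => c - m) μ :=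
    (integrable_const _).indicator hB
  -- The correction term is ±(c - m) according to the side of m, and 0 where g = m. It integrates to
  -- 0 because both sides have equal measure, while pointwise |g - m| plus the correction is at most
  -- |g - c|.
  have h0 : ∫ z, ({z | g z ≤ m}.indicator (fun _ => c - m) z
      - {z | m ≤ g z}.indicator (fun _ => c - m) z) ∂μ = 0 := by
    rw [integral_sub hIA hIB, integral_indicator_const _ hA, integral_indicator_const _ hB,
      measureReal_def, measureReal_def, h, sub_self]
  have h1 : ∫ z, (|g z - m| + ({z | g z ≤ m}.indicator (fun _ => c - m) z
      - {z | m ≤ g z}.indicator (fun _ => c - m) z)) ∂μ ≤ ∫ z, |g z - c| ∂μ := by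
    refine integral_mono ((hi m).add (hIA.sub hIB)) (hi c) fun z => ?_
    simp only [indicator, mem_ofPred_eq]
    split_ifs <;> rcases abs_cases (g z - m) with h | h <;>
      rcases abs_cases (g z - c) with h' | h' <;> linarith
  have h2 := integral_add (hi m) (hIA.sub hIB)
  simp only [Pi.sub_apply] at h2
  rwa [h2, h0, add_zero] at h1

/-! ### Strips halved by the two axis-parallel lines through a point -/

/-- A point of the plane together with a strip that serves as its Voronoi cell. -/
structure Site where
  /-- the point -/
  pt : ℝ × ℝ
  /-- the least second coordinate of the strip -/
  bot : ℝ
  /-- the greatest second coordinate of the strip -/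
  top : ℝ
  /-- the left boundary of the strip -/
  left : ℝ → ℝ
  /-- the right boundary of the strip -/
  right : ℝ → ℝ

namespace Site

/-- The closed cell of a site. -/
def closedCell (s : Site) : Set (ℝ × ℝ) := closedStrip s.bot s.top s.left s.right

/-- The open cell of a site. -/
def openCell (s : Site) : Set (ℝ × ℝ) := openStrip s.bot s.top s.left s.right

/-- The strip of a site is bounded by continuous graphs and contains its point. -/
structure Regular (s : Site) : Prop where
  continuous_left : Continuous s.left
  continuous_right : Continuous s.right
  left_lt : ∀ y, s.bot ≤ y → y ≤ s.top → s.left y < s.pt.1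
  lt_right : ∀ y, s.bot ≤ y → y ≤ s.top → s.pt.1 < s.right y
  bot_lt : s.bot < s.pt.2
  lt_top : s.pt.2 < s.top

/-- The vertical and the horizontal line through the point cut the strip into halves of
area `A`. -/
structure Bisected (s : Site) (A : ℝ) : Prop where
  west : ∫ y in s.bot..s.top, (s.pt.1 - s.left y) = A
  east : ∫ y in s.bot..s.top, (s.right y - s.pt.1) = A
  south : ∫ y in s.bot..s.pt.2, (s.right y - s.left y) = A
  north : ∫ y in s.pt.2..s.top, (s.right y - s.left y) = A

variable {s : Site} {A : ℝ}

theorem Regular.left_lt_right (h : s.Regular) (y : ℝ) (h1 : s.bot ≤ y) (h2 : y ≤ s.top) :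
    s.left y < s.right y := (h.left_lt y h1 h2).trans (h.lt_right y h1 h2)

theorem Regular.closedCell_subset (h : s.Regular) : s.closedCell ⊆ closure s.openCell :=
  closedStrip_subset_closure_openStrip (h.bot_lt.trans h.lt_top) h.continuous_left
    h.continuous_right h.left_lt_right

theorem Regular.isCompact (h : s.Regular) : IsCompact s.closedCell :=
  isCompact_closedStrip h.continuous_left h.continuous_right h.left_lt_right

theorem Regular.ae_eq (h : s.Regular) {E : Set (ℝ × ℝ)} (h1 : s.openCell ⊆ E)
    (h2 : E ⊆ s.closedCell) : E =ᵐ[volume] s.closedCell := by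
  refine Filter.EventuallyLE.antisymm h2.eventuallyLE ?_
  exact (openStrip_ae_eq_closedStrip h.continuous_left h.continuous_right
    h.left_lt_right).symm.le.trans h1.eventuallyLE

theorem Regular.closure_eq (h : s.Regular) {E : Set (ℝ × ℝ)} (h1 : s.openCell ⊆ E)
    (h2 : E ⊆ s.closedCell) : closure E = s.closedCell :=
  (closure_minimal h2 h.isCompact.isClosed).antisymm
    (h.closedCell_subset.trans (closure_mono h1))

theorem Regular.volume_closedCell (h : s.Regular) (hb : s.Bisected A) :
    volume s.closedCell = ENNReal.ofReal (2 * A) := by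
  have hl := h.continuous_left
  have hr := h.continuous_right
  rw [closedCell, volume_closedStrip hl hr (h.bot_lt.trans h.lt_top).le
    fun y h1 h2 => (h.left_lt_right y h1 h2).le]
  have hi := (hr.sub hl).intervalIntegrable (μ := volume)
  have h1 := intervalIntegral.integral_add_adjacent_intervals (hi s.bot s.pt.2)
    (hi s.pt.2 s.top)
  simp only [Pi.sub_apply] at h1
  rw [← h1, hb.south, hb.north, two_mul]

theorem Regular.integral_dM_le (h : s.Regular) (hb : s.Bisected A) (q : ℝ × ℝ) :
    ∫ z in s.closedCell, dM z s.pt ≤ ∫ z in s.closedCell, dM z q := by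
  have hl := h.continuous_left
  have hr := h.continuous_right
  have hcd := h.bot_lt.trans h.lt_top
  have hfin : volume s.closedCell < ⊤ := h.isCompact.measure_lt_top
  have : IsFiniteMeasure (volume.restrict s.closedCell) := ⟨by simpa using hfin⟩
  have h1 : Integrable (fun z : ℝ × ℝ => z.1) (volume.restrict s.closedCell) :=
    continuous_fst.continuousOn.integrableOn_compact h.isCompact
  have h2 : Integrable (fun z : ℝ × ℝ => z.2) (volume.restrict s.closedCell) :=
    continuous_snd.continuousOn.integrableOn_compact h.isCompact
  have hs : ∀ q : ℝ × ℝ, ∫ z in s.closedCell, dM z q =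
      (∫ z in s.closedCell, |z.1 - q.1|) + ∫ z in s.closedCell, |z.2 - q.2| := fun q =>
    integral_add (h1.sub (integrable_const _)).abs (h2.sub (integrable_const _)).abs
  rw [hs, hs]
  -- The two coordinates are minimized independently; the median conditions are the west/east and
  -- the south/north equality of areas.
  refine add_le_add (integral_abs_sub_le_of_median h1 measurable_fst ?_ _)
    (integral_abs_sub_le_of_median h2 measurable_snd ?_ _)
  · rw [Measure.restrict_apply (measurableSet_le measurable_fst measurable_const),
      Measure.restrict_apply (measurableSet_le measurable_const measurable_fst)]
    have e1 : {z : ℝ × ℝ | z.1 ≤ s.pt.1} ∩ s.closedCell =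
        closedStrip s.bot s.top s.left fun _ => s.pt.1 := by
      ext z
      refine ⟨fun hz => ⟨hz.2.1, hz.2.2.1, hz.1⟩, fun hz => ⟨hz.2.2, hz.1, hz.2.1, ?_⟩⟩
      exact hz.2.2.trans (h.lt_right _ hz.1.1 hz.1.2).le
    have e2 : {z : ℝ × ℝ | s.pt.1 ≤ z.1} ∩ s.closedCell =
        closedStrip s.bot s.top (fun _ => s.pt.1) s.right := by
      ext z
      refine ⟨fun hz => ⟨hz.2.1, hz.1, hz.2.2.2⟩, fun hz => ⟨hz.2.1, hz.1, ?_, hz.2.2⟩⟩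
      exact (h.left_lt _ hz.1.1 hz.1.2).le.trans hz.2.1
    rw [e1, e2, volume_closedStrip hl continuous_const hcd.le
      fun y h1 h2 => (h.left_lt y h1 h2).le, volume_closedStrip continuous_const hr hcd.le
      fun y h1 h2 => (h.lt_right y h1 h2).le, hb.west, hb.east]
  · rw [Measure.restrict_apply (measurableSet_le measurable_snd measurable_const),
      Measure.restrict_apply (measurableSet_le measurable_const measurable_snd)]
    have e1 : {z : ℝ × ℝ | z.2 ≤ s.pt.2} ∩ s.closedCell =
        closedStrip s.bot s.pt.2 s.left s.right := by
      ext z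
      exact ⟨fun hz => ⟨⟨hz.2.1.1, hz.1⟩, hz.2.2⟩,
        fun hz => ⟨hz.1.2, ⟨hz.1.1, hz.1.2.trans h.lt_top.le⟩, hz.2⟩⟩
    have e2 : {z : ℝ × ℝ | s.pt.2 ≤ z.2} ∩ s.closedCell =
        closedStrip s.pt.2 s.top s.left s.right := by
      ext z
      exact ⟨fun hz => ⟨⟨hz.1, hz.2.1.2⟩, hz.2.2⟩,
        fun hz => ⟨hz.1.1, ⟨h.bot_lt.le.trans hz.1.1, hz.1.2⟩, hz.2⟩⟩
    rw [e1, e2, volume_closedStrip hl hr h.bot_lt.le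
      fun y h1 h2 => (h.left_lt_right y h1 (h2.trans h.lt_top.le)).le,
      volume_closedStrip hl hr h.lt_top.le
      fun y h1 h2 => (h.left_lt_right y (h.bot_lt.le.trans h1) h2).le, hb.south, hb.north]

end Site

/-! ### The boundary profile and its integrals -/

/-- The boundary between the cells of a block of width `36 / 49`, as a function of the second
coordinate. -/
def profile (y : ℝ) : ℝ := min (4 / 7) (2 / 7 + |y - 1 / 2|)

theorem continuous_profile : Continuous profile := by
  unfold profile
  fun_prop

/-- With the upper bound 4/7, this keeps the boundary between 14/49 and 28/49, strictly between the
first coordinates 12/49 and 30/49 of the points that it separates. -/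
theorem two_sevenths_le_profile (y : ℝ) : 2 / 7 ≤ profile y :=
  le_min (by norm_num) (by linarith [abs_nonneg (y - 1 / 2)])

theorem profile_le (y : ℝ) : profile y ≤ 4 / 7 := min_le_left _ _

/-- The profile is affine on each of the four intervals cut at 3/14, 1/2 and 11/14, which are also
the heights of the points; each interval contributes 6/49. -/
theorem integral_profile_bot : ∫ y in (0 : ℝ)..3 / 14, profile y = 6 / 49 := by
  rw [intervalIntegral.integral_congr (g := fun _ => (4 / 7 : ℝ))]
  · rw [intervalIntegral.integral_const, smul_eq_mul]
    norm_num
  · intro y hy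
    rw [uIcc_of_le (by norm_num)] at hy
    have := neg_le_abs (y - 1 / 2)
    exact min_eq_left (by linarith [hy.2])

theorem integral_profile_bot_mid : ∫ y in (3 / 14 : ℝ)..1 / 2, profile y = 6 / 49 := by
  rw [intervalIntegral.integral_congr (g := fun y => 11 / 14 - y)]
  · rw [intervalIntegral.integral_sub (by simp) (by simp), intervalIntegral.integral_const,
      integral_id, smul_eq_mul]
    norm_num
  · intro y hy
    rw [uIcc_of_le (by norm_num)] at hy
    have := abs_of_nonpos (show y - 1 / 2 ≤ 0 by linarith [hy.2])
    simp only [profile, this]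
    rw [min_eq_right (by linarith [hy.1])]
    ring

theorem integral_profile_mid_top : ∫ y in (1 / 2 : ℝ)..11 / 14, profile y = 6 / 49 := by
  rw [intervalIntegral.integral_congr (g := fun y => y - 3 / 14)]
  · rw [intervalIntegral.integral_sub (by simp) (by simp), intervalIntegral.integral_const,
      integral_id, smul_eq_mul]
    norm_num
  · intro y hy
    rw [uIcc_of_le (by norm_num)] at hy
    have := abs_of_nonneg (show 0 ≤ y - 1 / 2 by linarith [hy.1])
    simp only [profile, this]
    rw [min_eq_right (by linarith [hy.2])]
    ring

theorem integral_profile_top : ∫ y in (11 / 14 : ℝ)..1, profile y = 6 / 49 := by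
  rw [intervalIntegral.integral_congr (g := fun _ => (4 / 7 : ℝ))]
  · rw [intervalIntegral.integral_const, smul_eq_mul]
    norm_num
  · intro y hy
    rw [uIcc_of_le (by norm_num)] at hy
    have := le_abs_self (y - 1 / 2)
    exact min_eq_left (by linarith [hy.1])

theorem intervalIntegrable_profile (c d : ℝ) : IntervalIntegrable profile volume c d :=
  continuous_profile.intervalIntegrable c d

theorem integral_profile_lower_half : ∫ y in (0 : ℝ)..1 / 2, profile y = 12 / 49 := by
  rw [← intervalIntegral.integral_add_adjacent_intervals (intervalIntegrable_profile 0 (3 / 14))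
    (intervalIntegrable_profile _ _), integral_profile_bot, integral_profile_bot_mid]
  norm_num

theorem integral_profile_upper_half : ∫ y in (1 / 2 : ℝ)..1, profile y = 12 / 49 := by
  rw [← intervalIntegral.integral_add_adjacent_intervals
    (intervalIntegrable_profile (1 / 2) (11 / 14)) (intervalIntegrable_profile _ _),
    integral_profile_mid_top, integral_profile_top]
  norm_num

theorem integral_profile : ∫ y in (0 : ℝ)..1, profile y = 24 / 49 := by
  rw [← intervalIntegral.integral_add_adjacent_intervals (intervalIntegrable_profile 0 (1 / 2))
    (intervalIntegrable_profile _ _), integral_profile_lower_half, integral_profile_upper_half]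
  norm_num

theorem integral_const_add_mul_profile (α β c d : ℝ) :
    ∫ y in c..d, (α + β * profile y) = (d - c) * α + β * ∫ y in c..d, profile y := by
  rw [intervalIntegral.integral_add (by simp) ((intervalIntegrable_profile c d).const_mul β),
    intervalIntegral.integral_const, intervalIntegral.integral_const_mul, smul_eq_mul]

/-- A site whose strip is bounded by the graphs of `α + α' * profile` and
`β + β' * profile`. -/
def profileSite (x y c d α α' β β' : ℝ) : Site where
  pt := (x, y)
  bot := c
  top := d
  left t := α + α' * profile t
  right t := β + β' * profile t

theorem profileSite_bisected {x y c d α α' β β' A : ℝ}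
    (hw : (d - c) * (x - α) - α' * ∫ t in c..d, profile t = A)
    (he : (d - c) * (β - x) + β' * ∫ t in c..d, profile t = A)
    (hs : (y - c) * (β - α) + (β' - α') * ∫ t in c..y, profile t = A)
    (hn : (d - y) * (β - α) + (β' - α') * ∫ t in y..d, profile t = A) :
    (profileSite x y c d α α' β β').Bisected A := by
  constructor
  · rw [← hw, sub_eq_add_neg, ← neg_mul, ← integral_const_add_mul_profile]
    exact congrArg (intervalIntegral · _ _ _) (by ext t; simp only [profileSite]; ring)
  · rw [← he, ← integral_const_add_mul_profile]
    exact congrArg (intervalIntegral · _ _ _) (by ext t; simp only [profileSite]; ring)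
  · rw [← hs, ← integral_const_add_mul_profile]
    exact congrArg (intervalIntegral · _ _ _) (by ext t; simp only [profileSite]; ring)
  · rw [← hn, ← integral_const_add_mul_profile]
    exact congrArg (intervalIntegral · _ _ _) (by ext t; simp only [profileSite]; ring)

/-! ### The cells of a single block -/

/-- The three kinds of blocks: `R₃`, its mirror image, and `R₅`. -/
inductive Block
  | three
  | threeMirror
  | five

namespace Block

/-- The configuration of a block. -/
def config : Block → Config
  | three => R3
  | threeMirror => R3.reflect
  | five => R5

/-- The width of a block. -/
def width : Block → ℝ
  | three => 36 / 49
  | threeMirror => 36 / 49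
  | five => 60 / 49

/-- The sites of a block whose left boundary has first coordinate `a`. -/
def sites (a : ℝ) : Block → List Site
  | three => [profileSite (a + 12 / 49) (3 / 14) 0 (1 / 2) a 0 a 1,
      profileSite (a + 12 / 49) (11 / 14) (1 / 2) 1 a 0 a 1,
      profileSite (a + 30 / 49) (1 / 2) 0 1 a 1 (a + 36 / 49) 0]
  | threeMirror => [profileSite (a + 24 / 49) (3 / 14) 0 (1 / 2) (a + 36 / 49) (-1) (a + 36 / 49) 0,
      profileSite (a + 24 / 49) (11 / 14) (1 / 2) 1 (a + 36 / 49) (-1) (a + 36 / 49) 0,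
      profileSite (a + 6 / 49) (1 / 2) 0 1 a 0 (a + 36 / 49) (-1)]
  | five => [profileSite (a + 12 / 49) (3 / 14) 0 (1 / 2) a 0 a 1,
      profileSite (a + 12 / 49) (11 / 14) (1 / 2) 1 a 0 a 1,
      profileSite (a + 30 / 49) (1 / 2) 0 1 a 1 (a + 60 / 49) (-1),
      profileSite (a + 48 / 49) (3 / 14) 0 (1 / 2) (a + 60 / 49) (-1) (a + 60 / 49) 0,
      profileSite (a + 48 / 49) (11 / 14) (1 / 2) 1 (a + 60 / 49) (-1) (a + 60 / 49) 0]

theorem regular_of_mem_sites {a : ℝ} {k : Block} {s : Site} (hs : s ∈ k.sites a) :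
    s.Regular := by
  have hc : ∀ α β : ℝ, Continuous fun t => α + β * profile t := fun α β =>
    continuous_const.add (continuous_const.mul continuous_profile)
  cases k <;> simp only [sites, List.mem_cons, List.not_mem_nil, or_false] at hs <;>
    rcases hs with rfl | rfl | rfl | rfl | rfl <;>
    refine ⟨hc _ _, hc _ _, fun y _ _ => ?_, fun y _ _ => ?_, ?_, ?_⟩ <;>
    simp only [profileSite] <;>
    first
    | norm_num
      done
    | linarith [two_sevenths_le_profile y, profile_le y]

theorem bisected_of_mem_sites {a : ℝ} {k : Block} {s : Site} (hs : s ∈ k.sites a) :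
    s.Bisected (6 / 49) := by
  cases k <;> simp only [sites, List.mem_cons, List.not_mem_nil, or_false] at hs <;>
    rcases hs with rfl | rfl | rfl | rfl | rfl <;>
    apply profileSite_bisected <;>
    simp only [integral_profile, integral_profile_lower_half, integral_profile_upper_half,
      integral_profile_bot, integral_profile_bot_mid, integral_profile_mid_top,
      integral_profile_top] <;> ring

/-- A corner point and the central point differ by 18/49 horizontally and 14/49 vertically. Their
bisector is therefore vertical at x = a + 4/7 (up to mirroring) outside the heights between them and
diagonal in between, which is the profile. What remains is a finite check of piecewise linear
inequalities. -/
theorem dM_lt_of_mem_openCell {a : ℝ} {k : Block} {s t : Site} (hs : s ∈ k.sites a)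
    (ht : t ∈ k.sites a) (hst : t.pt ≠ s.pt) {z : ℝ × ℝ} (hz : z ∈ s.openCell) :
    dM z s.pt < dM z t.pt := by
  obtain ⟨x, y⟩ := z
  obtain ⟨⟨h1, h2⟩, h3, h4⟩ := hz
  cases k <;> simp only [sites, List.mem_cons, List.not_mem_nil, or_false] at hs ht <;>
    rcases hs with rfl | rfl | rfl | rfl | rfl <;> rcases ht with rfl | rfl | rfl | rfl | rfl <;>
    first
    | exact absurd rfl hst
    | (simp only [profileSite, dM, profile] at *
       clear hst
       grind)

end Block

namespace Block

theorem width_pos (k : Block) : 0 < k.width := by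
  cases k <;> norm_num [width]

/-- The rectangle of a block whose left boundary has first coordinate `a`. -/
def slab (a : ℝ) (k : Block) : Set (ℝ × ℝ) := Icc a (a + k.width) ×ˢ Icc 0 1

theorem openCell_subset {a : ℝ} {k : Block} {s : Site} (hs : s ∈ k.sites a) :
    s.openCell ⊆ Ioo a (a + k.width) ×ˢ Ioo 0 1 := by
  rintro ⟨x, y⟩ ⟨⟨h1, h2⟩, h3, h4⟩
  have := two_sevenths_le_profile y
  have := profile_le y
  simp only [mem_prod, mem_Ioo]
  cases k <;> simp only [sites, List.mem_cons, List.not_mem_nil, or_false] at hs <;>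
    rcases hs with rfl | rfl | rfl | rfl | rfl <;>
    simp only [profileSite, width] at * <;>
    refine ⟨⟨?_, ?_⟩, ?_, ?_⟩ <;> linarith

theorem closedCell_subset {a : ℝ} {k : Block} {s : Site} (hs : s ∈ k.sites a) :
    s.closedCell ⊆ k.slab a :=
  (regular_of_mem_sites hs).closedCell_subset.trans <| closure_minimal
    ((openCell_subset hs).trans (prod_mono Ioo_subset_Icc_self Ioo_subset_Icc_self))
    (isClosed_Icc.prod isClosed_Icc)

theorem exists_mem_closedCell {a : ℝ} {k : Block} {z : ℝ × ℝ} (hz : z ∈ k.slab a) :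
    ∃ s ∈ k.sites a, z ∈ s.closedCell := by
  obtain ⟨x, y⟩ := z
  obtain ⟨⟨h1, h2⟩, h3, h4⟩ := hz
  have := two_sevenths_le_profile y
  have := profile_le y
  cases k <;>
    simp only [sites, List.exists_mem_cons_iff, List.not_mem_nil, false_and, exists_false, or_false,
      Site.closedCell, closedStrip, mem_ofPred_eq, profileSite, width] at * <;> grind

theorem eq_of_pt_eq {a : ℝ} {k : Block} {s t : Site} (hs : s ∈ k.sites a) (ht : t ∈ k.sites a)
    (h : s.pt = t.pt) : s = t := by
  cases k <;> simp only [sites, List.mem_cons, List.not_mem_nil, or_false] at hs ht <;>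
    rcases hs with rfl | rfl | rfl | rfl | rfl <;> rcases ht with rfl | rfl | rfl | rfl | rfl <;>
    first
    | rfl
    | (exfalso
       simp only [profileSite, Prod.mk.injEq] at h
       norm_num at h)

theorem dM_le_of_mem_closedCell {a : ℝ} {k : Block} {s t : Site} (hs : s ∈ k.sites a)
    (ht : t ∈ k.sites a) {z : ℝ × ℝ} (hz : z ∈ s.openCell) :
    dM z s.pt ≤ dM z t.pt := by
  by_cases h : t.pt = s.pt
  · rw [h]
  · exact (dM_lt_of_mem_openCell hs ht h hz).le

theorem pt_mem {a : ℝ} {k : Block} {s : Site} (hs : s ∈ k.sites a) :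
    (a + 6 / 49 ≤ s.pt.1 ∧ s.pt.1 + 6 / 49 ≤ a + k.width) ∧ 3 / 14 ≤ s.pt.2 ∧ s.pt.2 ≤ 11 / 14 := by
  cases k <;> simp only [sites, List.mem_cons, List.not_mem_nil, or_false] at hs <;>
    rcases hs with rfl | rfl | rfl | rfl | rfl <;> simp only [profileSite, width] <;>
    refine ⟨⟨?_, ?_⟩, ?_, ?_⟩ <;> linarith

/-! ### Comparing distances across block boundaries -/

/-- The pairs of blocks that may follow each other: their points next to the common boundary
are mirror images of each other. -/
def Compatible : Block → Block → Prop
  | three, threeMirror => True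
  | threeMirror, three => True
  | threeMirror, five => True
  | five, three => True
  | _, _ => False

theorem Compatible.ne {k l : Block} (h : Compatible k l) : k ≠ l := by
  rintro rfl
  cases k <;> exact h

/-- A placed block lies to the left of another one, either directly and with mirror symmetry at
the common boundary, or at some distance. -/
def Precedes (B C : ℝ × Block) : Prop :=
  (C.1 = B.1 + B.2.width ∧ Compatible B.2 C.2) ∨ B.1 + B.2.width + 36 / 49 ≤ C.1

/-- Either q is at or beyond the mirror image of the central point, or it is so far away that 24/49
exceeds 6/49 plus the largest possible vertical gain 2/7. -/
theorem dM_mid_lt_right {w : ℝ} {z q : ℝ × ℝ} (hz : z.1 < w)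
    (hq : (w + 6 / 49 ≤ q.1 ∧ q.2 = 1 / 2) ∨ (w + 24 / 49 ≤ q.1 ∧ 3 / 14 ≤ q.2 ∧ q.2 ≤ 11 / 14)) :
    dM z (w - 6 / 49, 1 / 2) < dM z q := by
  simp only [dM]
  grind

/-- A mirror-image q loses to the corner of the same height. Otherwise the corner nearer to z in
height costs at most 2/7 vertically, and 12/49 + 2/7 < 30/49. -/
theorem dM_corner_lt_right {w : ℝ} {z q : ℝ × ℝ} (hz : z.1 < w) (_hz0 : 0 ≤ z.2) (_hz1 : z.2 ≤ 1)
    (hq : (w + 12 / 49 ≤ q.1 ∧ (q.2 = 3 / 14 ∨ q.2 = 11 / 14)) ∨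
      (w + 30 / 49 ≤ q.1 ∧ 3 / 14 ≤ q.2 ∧ q.2 ≤ 11 / 14)) :
    dM z (w - 12 / 49, 3 / 14) < dM z q ∨ dM z (w - 12 / 49, 11 / 14) < dM z q := by
  simp only [dM]
  grind

theorem dM_reflect (z q : ℝ × ℝ) : dM (-z.1, z.2) (-q.1, q.2) = dM z q := by
  simp only [dM]
  rw [neg_sub_neg, abs_sub_comm]

theorem dM_mid_lt_left {w : ℝ} {z q : ℝ × ℝ} (hz : w < z.1)
    (hq : (q.1 + 6 / 49 ≤ w ∧ q.2 = 1 / 2) ∨ (q.1 + 24 / 49 ≤ w ∧ 3 / 14 ≤ q.2 ∧ q.2 ≤ 11 / 14)) :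
    dM z (w + 6 / 49, 1 / 2) < dM z q := by
  rw [← dM_reflect, ← dM_reflect z q, neg_add']
  apply dM_mid_lt_right (w := -w) (neg_lt_neg hz)
  grind

theorem dM_corner_lt_left {w : ℝ} {z q : ℝ × ℝ} (hz : w < z.1) (hz0 : 0 ≤ z.2) (hz1 : z.2 ≤ 1)
    (hq : (q.1 + 12 / 49 ≤ w ∧ (q.2 = 3 / 14 ∨ q.2 = 11 / 14)) ∨
      (q.1 + 30 / 49 ≤ w ∧ 3 / 14 ≤ q.2 ∧ q.2 ≤ 11 / 14)) :
    dM z (w + 12 / 49, 3 / 14) < dM z q ∨ dM z (w + 12 / 49, 11 / 14) < dM z q := by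
  rw [← dM_reflect, ← dM_reflect z (w + 12 / 49, 11 / 14), ← dM_reflect z q, neg_add']
  apply dM_corner_lt_right (z := (-z.1, z.2)) (w := -w) (neg_lt_neg hz) hz0 hz1
  grind

theorem exists_dM_lt_right {B C : ℝ × Block} (h : Precedes B C) {t : Site}
    (ht : t ∈ C.2.sites C.1) {z : ℝ × ℝ} (hz : z ∈ Ioo B.1 (B.1 + B.2.width) ×ˢ Ioo (0 : ℝ) 1) :
    ∃ s ∈ B.2.sites B.1, dM z s.pt < dM z t.pt := by
  obtain ⟨⟨-, hz⟩, hz0, hz1⟩ := hz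
  obtain ⟨a, k⟩ := B
  obtain ⟨b, l⟩ := C
  have hp := pt_mem ht
  -- On its right side `three` shows its central point, whereas the other two kinds show a pair of
  -- corner points.
  have key : (k = three ∧ dM z (a + k.width - 6 / 49, 1 / 2) < dM z t.pt) ∨ k ≠ three ∧
      (dM z (a + k.width - 12 / 49, 3 / 14) < dM z t.pt ∨
        dM z (a + k.width - 12 / 49, 11 / 14) < dM z t.pt) := by
    rcases h with ⟨rfl, h⟩ | h
    · cases k <;> cases l <;> simp only [Compatible] at h <;>
        simp only [sites, List.mem_cons, List.not_mem_nil, or_false] at ht <;>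
        first
        | refine Or.inl ⟨rfl, dM_mid_lt_right hz ?_⟩
          rcases ht with rfl | rfl | rfl | rfl | rfl <;> simp only [profileSite] <;> grind
        | refine Or.inr ⟨nofun, dM_corner_lt_right hz hz0.le hz1.le ?_⟩
          rcases ht with rfl | rfl | rfl | rfl | rfl <;> simp only [profileSite] <;> grind
    · dsimp only at h hp
      by_cases hk : k = three
      · exact Or.inl ⟨hk, dM_mid_lt_right hz (Or.inr ⟨by linarith [hp.1.1], hp.2⟩)⟩
      · exact Or.inr ⟨hk, dM_corner_lt_right hz hz0.le hz1.le (Or.inr ⟨by linarith [hp.1.1], hp.2⟩)⟩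
  -- Normalizing the arithmetic identifies points measured from the right boundary with the same
  -- points measured from the left one.
  cases k <;> simp only [sites, List.exists_mem_cons_iff, List.not_mem_nil, false_and, exists_false,
    or_false, profileSite, width, reduceCtorEq, ne_eq, not_true, not_false_eq_true, true_and,
    false_or] at key ⊢ <;> ring_nf at key ⊢ <;> tauto

theorem exists_dM_lt_left {B C : ℝ × Block} (h : Precedes B C) {t : Site}
    (ht : t ∈ B.2.sites B.1) {z : ℝ × ℝ} (hz : z ∈ Ioo C.1 (C.1 + C.2.width) ×ˢ Ioo (0 : ℝ) 1) :
    ∃ s ∈ C.2.sites C.1, dM z s.pt < dM z t.pt := by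
  obtain ⟨⟨hz, -⟩, hz0, hz1⟩ := hz
  obtain ⟨a, k⟩ := B
  obtain ⟨b, l⟩ := C
  have hp := pt_mem ht
  have key : (l = threeMirror ∧ dM z (b + 6 / 49, 1 / 2) < dM z t.pt) ∨ l ≠ threeMirror ∧
      (dM z (b + 12 / 49, 3 / 14) < dM z t.pt ∨ dM z (b + 12 / 49, 11 / 14) < dM z t.pt) := by
    rcases h with ⟨rfl, h⟩ | h
    · cases k <;> cases l <;> simp only [Compatible] at h <;>
        simp only [sites, List.mem_cons, List.not_mem_nil, or_false] at ht <;>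
        first
        | refine Or.inl ⟨rfl, dM_mid_lt_left hz ?_⟩
          rcases ht with rfl | rfl | rfl | rfl | rfl <;> simp only [profileSite, width] <;> grind
        | refine Or.inr ⟨nofun, dM_corner_lt_left hz hz0.le hz1.le ?_⟩
          rcases ht with rfl | rfl | rfl | rfl | rfl <;> simp only [profileSite, width] <;> grind
    · dsimp only at h hp
      by_cases hk : l = threeMirror
      · exact Or.inl ⟨hk, dM_mid_lt_left hz (Or.inr ⟨by linarith [hp.1.2], hp.2⟩)⟩
      · exact Or.inr ⟨hk, dM_corner_lt_left hz hz0.le hz1.le (Or.inr ⟨by linarith [hp.1.2], hp.2⟩)⟩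
  cases l <;> simp only [sites, List.exists_mem_cons_iff, List.not_mem_nil, false_and, exists_false,
    or_false, profileSite, reduceCtorEq, ne_eq, not_true, not_false_eq_true, true_and,
    false_or] at key ⊢ <;> ring_nf at key ⊢ <;> tauto

end Block

/-! ### Interlocking cells -/

/-- Every rectangle that contains the open cell of `s` meets the open cell of `t`. -/
def Site.Linked (s t : Site) : Prop :=
  ∃ z ∈ s.openCell, ∃ w ∈ s.openCell, (z.1, w.2) ∈ t.openCell

/-- Three corners of a box of sides x, y and x, y' suffice up to sliding: x' and x'' only show that
the heights y' and y occur in the cells of s and m. -/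
theorem Site.linked_of_mem {s m : Site} {x x' x'' y y' : ℝ} (h1 : (x, y) ∈ s.openCell)
    (h2 : (x', y') ∈ s.openCell) (h3 : (x, y') ∈ m.openCell) (h4 : (x'', y) ∈ m.openCell) :
    s.Linked m ∧ m.Linked s :=
  ⟨⟨_, h1, _, h2, h3⟩, _, h3, _, h4, h1⟩

theorem profile_of_abs_eq {y u : ℝ} (h : |y - 1 / 2| = u) : profile y = min (4 / 7) (2 / 7 + u) := by
  rw [profile, h]

/-- Here m is the central site. At heights 1/10 and 9/10 the boundary is at 28/49, near height 1/2
it is close to 14/49, so the vertical line at 25/49 (or its mirror image) passes through both cells.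
The extra site n serves to show that one cell is not a whole block. -/
theorem Block.exists_linked (a : ℝ) (k : Block) : ∃ m ∈ k.sites a, ∃ n ∈ k.sites a, n ≠ m ∧
    ∀ s ∈ k.sites a, s ≠ m → s.Linked m ∧ m.Linked s := by
  have hb : profile (1 / 10) = 4 / 7 := by
    rw [profile_of_abs_eq (u := 2 / 5) (by norm_num [abs_of_neg])]; norm_num
  have ht : profile (9 / 10) = 4 / 7 := by
    rw [profile_of_abs_eq (u := 2 / 5) (by norm_num)]; norm_num
  have hb' : profile (49 / 100) = 207 / 700 := by
    rw [profile_of_abs_eq (u := 1 / 100) (by norm_num [abs_of_neg])]; norm_num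
  have ht' : profile (51 / 100) = 207 / 700 := by
    rw [profile_of_abs_eq (u := 1 / 100) (by norm_num)]; norm_num
  have hne : ∀ {s t : Site}, s.bot ≠ t.bot ∨ s.top ≠ t.top → s ≠ t := by
    rintro s _ h rfl
    simp at h
  cases k <;> simp only [sites, List.mem_cons, List.not_mem_nil, or_false]
  · refine ⟨_, Or.inr (Or.inr rfl), _, Or.inl rfl, hne (by norm_num [profileSite]), ?_⟩
    rintro s (rfl | rfl | rfl) hs
    · apply Site.linked_of_mem (x := a + 25 / 49) (x' := a + 12 / 49) (x'' := a + 30 / 49)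
        (y := 1 / 10) (y' := 49 / 100) <;>
      simp only [Site.openCell, openStrip, mem_ofPred_eq, profileSite, hb, hb'] <;>
      refine ⟨⟨?_, ?_⟩, ?_, ?_⟩ <;> linarith
    · apply Site.linked_of_mem (x := a + 25 / 49) (x' := a + 12 / 49) (x'' := a + 30 / 49)
        (y := 9 / 10) (y' := 51 / 100) <;>
      simp only [Site.openCell, openStrip, mem_ofPred_eq, profileSite, ht, ht'] <;>
      refine ⟨⟨?_, ?_⟩, ?_, ?_⟩ <;> linarith
    · exact absurd rfl hs
  · refine ⟨_, Or.inr (Or.inr rfl), _, Or.inl rfl, hne (by norm_num [profileSite]), ?_⟩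
    rintro s (rfl | rfl | rfl) hs
    · apply Site.linked_of_mem (x := a + 11 / 49) (x' := a + 24 / 49) (x'' := a + 6 / 49)
        (y := 1 / 10) (y' := 49 / 100) <;>
      simp only [Site.openCell, openStrip, mem_ofPred_eq, profileSite, hb, hb'] <;>
      refine ⟨⟨?_, ?_⟩, ?_, ?_⟩ <;> linarith
    · apply Site.linked_of_mem (x := a + 11 / 49) (x' := a + 24 / 49) (x'' := a + 6 / 49)
        (y := 9 / 10) (y' := 51 / 100) <;>
      simp only [Site.openCell, openStrip, mem_ofPred_eq, profileSite, ht, ht'] <;>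
      refine ⟨⟨?_, ?_⟩, ?_, ?_⟩ <;> linarith
    · exact absurd rfl hs
  · refine ⟨_, Or.inr (Or.inr (Or.inl rfl)), _, Or.inl rfl, hne (by norm_num [profileSite]), ?_⟩
    rintro s (rfl | rfl | rfl | rfl | rfl) hs
    · apply Site.linked_of_mem (x := a + 25 / 49) (x' := a + 12 / 49) (x'' := a + 30 / 49)
        (y := 1 / 10) (y' := 49 / 100) <;>
      simp only [Site.openCell, openStrip, mem_ofPred_eq, profileSite, hb, hb'] <;>
      refine ⟨⟨?_, ?_⟩, ?_, ?_⟩ <;> linarith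
    · apply Site.linked_of_mem (x := a + 25 / 49) (x' := a + 12 / 49) (x'' := a + 30 / 49)
        (y := 9 / 10) (y' := 51 / 100) <;>
      simp only [Site.openCell, openStrip, mem_ofPred_eq, profileSite, ht, ht'] <;>
      refine ⟨⟨?_, ?_⟩, ?_, ?_⟩ <;> linarith
    · exact absurd rfl hs
    · apply Site.linked_of_mem (x := a + 35 / 49) (x' := a + 48 / 49) (x'' := a + 30 / 49)
        (y := 1 / 10) (y' := 49 / 100) <;>
      simp only [Site.openCell, openStrip, mem_ofPred_eq, profileSite, hb, hb'] <;>
      refine ⟨⟨?_, ?_⟩, ?_, ?_⟩ <;> linarith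
    · apply Site.linked_of_mem (x := a + 35 / 49) (x' := a + 48 / 49) (x'' := a + 30 / 49)
        (y := 9 / 10) (y' := 51 / 100) <;>
      simp only [Site.openCell, openStrip, mem_ofPred_eq, profileSite, ht, ht'] <;>
      refine ⟨⟨?_, ?_⟩, ?_, ?_⟩ <;> linarith

/-! ### Configurations tiled by compatible blocks -/

/-- The points of a block whose left boundary has first coordinate `a`. -/
def Block.pts (a : ℝ) (k : Block) : Finset (ℝ × ℝ) := ((k.sites a).map Site.pt).toFinset

theorem Block.mem_pts {a : ℝ} {k : Block} {p : ℝ × ℝ} :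
    p ∈ k.pts a ↔ ∃ s ∈ k.sites a, s.pt = p := by
  simp [Block.pts]

theorem Block.pts_nonempty (a : ℝ) (k : Block) : (k.pts a).Nonempty := by
  obtain ⟨m, hm, -⟩ := k.exists_linked a
  exact ⟨_, Block.mem_pts.2 ⟨m, hm, rfl⟩⟩

/-- The configuration `C` is tiled by the placed blocks in the list `D`. -/
structure IsTiling (C : Config) (D : List (ℝ × Block)) : Prop where
  mem_points : ∀ {p}, p ∈ C.points ↔ ∃ B ∈ D, p ∈ B.2.pts B.1
  pairwise : D.Pairwise Block.Precedes
  slab_subset : ∀ B ∈ D, B.2.slab B.1 ⊆ C.rect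
  cover : C.points.Nonempty → ∀ z ∈ C.rect, ∃ B ∈ D, z ∈ B.2.slab B.1

theorem Block.Precedes.le {B B' : ℝ × Block} (h : Block.Precedes B B') :
    B.1 + B.2.width ≤ B'.1 := by
  rcases h with h | h
  · exact h.1.ge
  · linarith

theorem Block.Precedes.disjoint {B B' : ℝ × Block} (h : Block.Precedes B B') :
    Disjoint (B.2.pts B.1) (B'.2.pts B'.1) := by
  rw [Finset.disjoint_left]
  intro p hp hp'
  obtain ⟨s, hs, rfl⟩ := Block.mem_pts.1 hp
  obtain ⟨t, ht, he⟩ := Block.mem_pts.1 hp'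
  have h1 := (Block.pt_mem hs).1.2
  have h2 := (Block.pt_mem ht).1.1
  rw [he] at h2
  linarith [h.le]

namespace IsTiling

variable {C : Config} {D : List (ℝ × Block)} {B B' : ℝ × Block} {s t : Site}

theorem precedes_or (h : IsTiling C D) (hB : B ∈ D) (hB' : B' ∈ D) (hne : B ≠ B') :
    Block.Precedes B B' ∨ Block.Precedes B' B := by
  -- The order of the list is forgotten by symmetrizing the relation; it is made vacuous on the
  -- diagonal, where nothing is known.
  let r : ℝ × Block → ℝ × Block → Prop := fun B B' =>
    B ≠ B' → Block.Precedes B B' ∨ Block.Precedes B' B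
  have : Std.Symm r := ⟨fun _ _ h hne => (h hne.symm).symm⟩
  have h1 : D.Pairwise r := h.pairwise.imp fun h _ => Or.inl h
  exact h1.forall_of_forall (fun _ _ hne => absurd rfl hne) hB hB' hne

theorem disjoint_pts (h : IsTiling C D) (hB : B ∈ D) (hB' : B' ∈ D) (hne : B ≠ B') :
    Disjoint (B.2.pts B.1) (B'.2.pts B'.1) :=
  (h.precedes_or hB hB' hne).elim (fun h => h.disjoint) fun h => h.disjoint.symm

theorem pt_mem (h : IsTiling C D) (hB : B ∈ D) (hs : s ∈ B.2.sites B.1) : s.pt ∈ C.points :=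
  h.mem_points.2 ⟨B, hB, Block.mem_pts.2 ⟨s, hs, rfl⟩⟩

theorem eq_of_pt_eq (h : IsTiling C D) (hB : B ∈ D) (hs : s ∈ B.2.sites B.1) (hB' : B' ∈ D)
    (ht : t ∈ B'.2.sites B'.1) (he : s.pt = t.pt) : s = t := by
  by_cases hne : B = B'
  · subst hne
    exact Block.eq_of_pt_eq hs ht he
  · exact absurd (Block.mem_pts.2 ⟨t, ht, he.symm⟩) (Finset.disjoint_left.1
      (h.disjoint_pts hB hB' hne) (Block.mem_pts.2 ⟨s, hs, rfl⟩))

theorem dM_lt (h : IsTiling C D) (hB : B ∈ D) (hs : s ∈ B.2.sites B.1) {z q : ℝ × ℝ}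
    (hz : z ∈ s.openCell) (hq : q ∈ C.points) (hne : q ≠ s.pt) : dM z s.pt < dM z q := by
  obtain ⟨B', hB', hq⟩ := h.mem_points.1 hq
  obtain ⟨t, ht, rfl⟩ := Block.mem_pts.1 hq
  by_cases hBB : B = B'
  · subst hBB
    exact Block.dM_lt_of_mem_openCell hs ht hne hz
  · have hz' := Block.openCell_subset hs hz
    obtain ⟨u, hu, hlt⟩ : ∃ u ∈ B.2.sites B.1, dM z u.pt < dM z t.pt := by
      rcases h.precedes_or hB hB' hBB with hp | hp
      · exact Block.exists_dM_lt_right hp ht hz'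
      · exact Block.exists_dM_lt_left hp ht hz'
    exact (Block.dM_le_of_mem_closedCell hs hu hz).trans_lt hlt

theorem dM_le (h : IsTiling C D) (hB : B ∈ D) (hs : s ∈ B.2.sites B.1) {z q : ℝ × ℝ}
    (hz : z ∈ s.closedCell) (hq : q ∈ C.points) : dM z s.pt ≤ dM z q := by
  have hc : ∀ q : ℝ × ℝ, Continuous fun z => dM z q := fun q => by
    unfold dM
    fun_prop
  have hsub : s.openCell ⊆ {z | dM z s.pt ≤ dM z q} := fun w hw => by
    by_cases hne : q = s.pt
    · subst hne
      exact le_refl (dM w s.pt)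
    · exact (h.dM_lt hB hs hw hq hne).le
  exact closure_minimal hsub (isClosed_le (hc _) (hc _))
    ((Block.regular_of_mem_sites hs).closedCell_subset hz)

theorem openCell_subset_cell (h : IsTiling C D) (hB : B ∈ D) (hs : s ∈ B.2.sites B.1) :
    s.openCell ⊆ C.cell s.pt := fun _ hz =>
  ⟨h.slab_subset B hB (Block.closedCell_subset hs (openStrip_subset_closedStrip hz)),
    fun _ hq hne => h.dM_lt hB hs hz hq hne⟩

/-- The closed cells cover the rectangle, and a point in the closed cell of another site is at least
as close to that site, contrary to strict minimality. -/
theorem cell_subset_closedCell (h : IsTiling C D) (hB : B ∈ D) (hs : s ∈ B.2.sites B.1) :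
    C.cell s.pt ⊆ s.closedCell := by
  rintro z ⟨hz, hmin⟩
  have hp := h.pt_mem hB hs
  obtain ⟨B', hB', hz'⟩ := h.cover ⟨_, hp⟩ z hz
  obtain ⟨t, ht, hzt⟩ := Block.exists_mem_closedCell hz'
  by_cases he : t.pt = s.pt
  · rwa [h.eq_of_pt_eq hB hs hB' ht he.symm]
  · exact absurd (h.dM_le hB' ht hzt hp) (hmin _ (h.pt_mem hB' ht) he).not_ge

theorem cell_ae_eq (h : IsTiling C D) (hB : B ∈ D) (hs : s ∈ B.2.sites B.1) :
    C.cell s.pt =ᵐ[volume] s.closedCell :=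
  (Block.regular_of_mem_sites hs).ae_eq (h.openCell_subset_cell hB hs)
    (h.cell_subset_closedCell hB hs)

theorem closure_cell (h : IsTiling C D) (hB : B ∈ D) (hs : s ∈ B.2.sites B.1) :
    closure (C.cell s.pt) = s.closedCell :=
  (Block.regular_of_mem_sites hs).closure_eq (h.openCell_subset_cell hB hs)
    (h.cell_subset_closedCell hB hs)

theorem exists_site (h : IsTiling C D) {p : ℝ × ℝ} (hp : p ∈ C.points) :
    ∃ B ∈ D, ∃ s ∈ B.2.sites B.1, s.pt = p := by
  obtain ⟨B, hB, hp⟩ := h.mem_points.1 hp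
  exact ⟨B, hB, Block.mem_pts.1 hp⟩

theorem volume_cell (h : IsTiling C D) {p : ℝ × ℝ} (hp : p ∈ C.points) :
    volume (C.cell p) = ENNReal.ofReal (2 * (6 / 49)) := by
  obtain ⟨B, hB, s, hs, rfl⟩ := h.exists_site hp
  rw [measure_congr (h.cell_ae_eq hB hs),
    (Block.regular_of_mem_sites hs).volume_closedCell (Block.bisected_of_mem_sites hs)]

theorem balanced (h : IsTiling C D) : C.Balanced := by
  refine ⟨fun p hp q hq => by rw [h.volume_cell hp, h.volume_cell hq], fun p hp q => ?_⟩
  obtain ⟨B, hB, s, hs, rfl⟩ := h.exists_site hp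
  rw [setAverage_congr (h.cell_ae_eq hB hs), setAverage_congr (h.cell_ae_eq hB hs),
    setAverage_eq, setAverage_eq, smul_eq_mul, smul_eq_mul]
  exact mul_le_mul_of_nonneg_left
    ((Block.regular_of_mem_sites hs).integral_dM_le (Block.bisected_of_mem_sites hs) q)
    (inv_nonneg.2 measureReal_nonneg)

theorem mem_region {Q : Finset (ℝ × ℝ)} {z : ℝ × ℝ} :
    z ∈ C.region Q ↔ ∃ p ∈ Q, z ∈ closure (C.cell p) := by
  simp [Config.region, Q.closure_biUnion]

/-- A set of points whose cells form a rectangle is closed under links. -/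
theorem mem_of_linked (h : IsTiling C D) {Q : Finset (ℝ × ℝ)} (hQ : Q ⊆ C.points)
    (hrect : IsRectangle (C.region Q)) (hB : B ∈ D) (hs : s ∈ B.2.sites B.1)
    (ht : t ∈ B.2.sites B.1) (hl : s.Linked t) (hsQ : s.pt ∈ Q) : t.pt ∈ Q := by
  obtain ⟨z, hz, w, hw, hv⟩ := hl
  have hsub : s.openCell ⊆ C.region Q := fun x hx =>
    mem_region.2 ⟨_, hsQ, subset_closure (h.openCell_subset_cell hB hs hx)⟩
  have hvR : (z.1, w.2) ∈ C.region Q := by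
    have hz' := hsub hz
    have hw' := hsub hw
    obtain ⟨a, b, c, d, -, -, he⟩ := hrect
    rw [he] at hz' hw' ⊢
    exact ⟨hz'.1, hw'.2⟩
  -- The mixed point lies in the closed cell of some point of Q, but strictly inside the open cell
  -- of t, so that point of Q can only be t's.
  obtain ⟨p, hp, hvp⟩ := mem_region.1 hvR
  obtain ⟨B', hB', u, hu, rfl⟩ := h.exists_site (hQ hp)
  rw [h.closure_cell hB' hu] at hvp
  by_cases he : u.pt = t.pt
  · rwa [← he]
  · exact absurd (h.dM_le hB' hu hvp (h.pt_mem hB ht)) (h.dM_lt hB ht hv (hQ hp) he).not_ge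

theorem pts_subset_of_mem (h : IsTiling C D) {Q : Finset (ℝ × ℝ)} (hQ : C.IsSubconfig Q)
    (hB : B ∈ D) {p : ℝ × ℝ} (hp : p ∈ B.2.pts B.1) (hpQ : p ∈ Q) : B.2.pts B.1 ⊆ Q := by
  obtain ⟨s, hs, rfl⟩ := Block.mem_pts.1 hp
  obtain ⟨m, hm, -, -, -, hlink⟩ := B.2.exists_linked B.1
  have hmQ : m.pt ∈ Q := by
    by_cases he : s = m
    · rwa [← he]
    · exact h.mem_of_linked hQ.1 hQ.2 hB hs hm (hlink s hs he).1 hpQ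
  intro q hq
  obtain ⟨t, ht, rfl⟩ := Block.mem_pts.1 hq
  by_cases he : t = m
  · rwa [he]
  · exact h.mem_of_linked hQ.1 hQ.2 hB hm ht (hlink t ht he).2 hmQ

theorem noRectangularCell (h : IsTiling C D) : C.NoRectangularCell := by
  intro p hp hrect
  have hR : C.region {p} = closure (C.cell p) := by simp [Config.region]
  have hQ : C.IsSubconfig {p} := ⟨by simpa using hp, by rwa [hR]⟩
  obtain ⟨B, hB, hpB⟩ := h.mem_points.1 hp
  have hsub := h.pts_subset_of_mem hQ hB hpB (Finset.mem_singleton_self p)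
  obtain ⟨m, hm, n, hn, hne, -⟩ := B.2.exists_linked B.1
  have hmp := Finset.mem_singleton.1 (hsub (Block.mem_pts.2 ⟨m, hm, rfl⟩))
  have hnp := Finset.mem_singleton.1 (hsub (Block.mem_pts.2 ⟨n, hn, rfl⟩))
  exact hne (Block.eq_of_pt_eq hn hm (hnp.trans hmp.symm))

theorem region_pts (h : IsTiling C D) (hB : B ∈ D) :
    C.region (B.2.pts B.1) = B.2.slab B.1 := by
  ext z
  rw [mem_region]
  constructor
  · rintro ⟨p, hp, hz⟩
    obtain ⟨s, hs, rfl⟩ := Block.mem_pts.1 hp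
    rw [h.closure_cell hB hs] at hz
    exact Block.closedCell_subset hs hz
  · intro hz
    obtain ⟨s, hs, hz⟩ := Block.exists_mem_closedCell hz
    exact ⟨s.pt, Block.mem_pts.2 ⟨s, hs, rfl⟩, by rwa [h.closure_cell hB hs]⟩

theorem isSubconfig_pts (h : IsTiling C D) (hB : B ∈ D) : C.IsSubconfig (B.2.pts B.1) :=
  ⟨fun _ hp => h.mem_points.2 ⟨B, hB, hp⟩, by
    rw [h.region_pts hB]
    exact ⟨_, _, _, _, lt_add_of_pos_right _ B.2.width_pos, zero_lt_one, rfl⟩⟩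

theorem exists_eq_pts_of_isAtomic (h : IsTiling C D) {Q : Finset (ℝ × ℝ)} (hQ : C.IsAtomic Q) :
    ∃ B ∈ D, Q = B.2.pts B.1 := by
  classical
  have hcov : ∀ p ∈ Q, ∃ B ∈ D, p ∈ B.2.pts B.1 ∧ B.2.pts B.1 ⊆ Q := fun p hp => by
    obtain ⟨B, hB, hpB⟩ := h.mem_points.1 (hQ.1.1 hp)
    exact ⟨B, hB, hpB, h.pts_subset_of_mem hQ.1 hB hpB hp⟩
  have hmem : ∀ T, T ∈ ((D.map fun B => B.2.pts B.1).toFinset.filter (· ⊆ Q)) ↔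
      (∃ B ∈ D, B.2.pts B.1 = T) ∧ T ⊆ Q := fun T => by simp
  -- A subconfiguration contains every block it meets, so its blocks partition it; atomicity leaves
  -- only one.
  let π : Finpartition Q :=
    { parts := (D.map fun B => B.2.pts B.1).toFinset.filter (· ⊆ Q)
      supIndep := by
        rw [Finset.supIndep_iff_pairwiseDisjoint]
        intro T hT T' hT' hne
        obtain ⟨⟨B, hB, rfl⟩, -⟩ := (hmem T).1 hT
        obtain ⟨⟨B', hB', rfl⟩, -⟩ := (hmem T').1 hT'
        exact h.disjoint_pts hB hB' fun he => hne (by rw [he])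
      sup_parts := by
        apply le_antisymm
        · exact Finset.sup_le fun T hT => ((hmem T).1 hT).2
        · intro p hp
          obtain ⟨B, hB, hpB, hsub⟩ := hcov p hp
          exact Finset.mem_sup.2 ⟨_, (hmem _).2 ⟨⟨B, hB, rfl⟩, hsub⟩, hpB⟩
      bot_notMem := fun hbot => by
        obtain ⟨⟨B, hB, he⟩, -⟩ := (hmem _).1 hbot
        exact (B.2.pts_nonempty B.1).ne_empty he }
  have hπ : π.parts = {Q} := hQ.2 π fun T hT => by
    obtain ⟨⟨B, hB, rfl⟩, -⟩ := (hmem T).1 hT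
    exact h.isSubconfig_pts hB
  have hQπ : Q ∈ π.parts := by simp [hπ]
  obtain ⟨⟨B, hB, he⟩, -⟩ := (hmem Q).1 hQπ
  exact ⟨B, hB, he.symm⟩

theorem eq_of_isCopy (h : IsTiling C D) (hB : B ∈ D) (hB' : B' ∈ D)
    (hc : C.IsCopy (B.2.pts B.1) (B'.2.pts B'.1)) : B.2 = B'.2 := by
  obtain ⟨v, hpts, hreg⟩ := hc
  rw [h.region_pts hB, h.region_pts hB'] at hreg
  obtain ⟨a, k⟩ := B
  obtain ⟨b, l⟩ := B'
  dsimp only at *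
  have hk := k.width_pos
  have hl := l.width_pos
  have hsub : ∀ z ∈ k.slab a, z + v ∈ l.slab b := fun z hz => hreg ▸ mem_image_of_mem _ hz
  have hsub' : ∀ w ∈ l.slab b, ∃ z ∈ k.slab a, z + v = w := fun w hw => by
    rwa [hreg] at hw
  have e1 := hsub (a, 0) ⟨⟨le_rfl, by dsimp only; linarith⟩, le_rfl, zero_le_one⟩
  have e2 := hsub (a + k.width, 1) ⟨⟨by dsimp only; linarith, le_rfl⟩, zero_le_one, le_rfl⟩
  obtain ⟨z1, hz1, e3⟩ := hsub' (b, 0) ⟨⟨le_rfl, by dsimp only; linarith⟩, le_rfl, zero_le_one⟩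
  obtain ⟨z2, hz2, e4⟩ :=
    hsub' (b + l.width, 1) ⟨⟨by dsimp only; linarith, le_rfl⟩, zero_le_one, le_rfl⟩
  simp only [Block.slab, mem_prod, mem_Icc, Prod.ext_iff, Prod.fst_add, Prod.snd_add]
    at e1 e2 e3 e4 hz1 hz2
  have hw : k.width = l.width := by linarith [hz1.1.1, hz2.1.2]
  have hv1 : v.1 = b - a := by linarith [hz1.1.1]
  have hv2 : v.2 = 0 := by linarith
  have himg : ∀ s ∈ k.sites a, ∃ t ∈ l.sites b, t.pt = s.pt + v := fun s hs => by
    rw [← Block.mem_pts, hpts]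
    exact Finset.mem_image_of_mem _ (Block.mem_pts.2 ⟨s, hs, rfl⟩)
  -- Equality of widths separates `five` from the rest. For `three` against `threeMirror`, the image
  -- of the first listed point has the wrong first coordinate.
  cases k <;> cases l <;> try rfl
  all_goals
    exfalso
    norm_num [Block.width] at hw
    try
      obtain ⟨t, ht, he⟩ := himg _ List.mem_cons_self
      simp only [Block.sites, List.mem_cons, List.not_mem_nil, or_false] at ht
      rcases ht with rfl | rfl | rfl <;>
        simp only [profileSite, Prod.ext_iff, Prod.fst_add, Prod.snd_add, hv1, hv2] at he <;>
        linarith [he.1, he.2]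

theorem nonRepetitive (h : IsTiling C D) : C.NonRepetitive := by
  rintro Q Q' hQ hQ' ⟨hdisj, x, hx, y, hy, -⟩ hcopy
  obtain ⟨B, hB, rfl⟩ := h.exists_eq_pts_of_isAtomic hQ
  obtain ⟨B', hB', rfl⟩ := h.exists_eq_pts_of_isAtomic hQ'
  have hne : B ≠ B' := by
    rintro rfl
    exact (B.2.pts_nonempty B.1).ne_empty (by simpa using hdisj)
  have he := h.eq_of_isCopy hB hB' hcopy
  rw [h.region_pts hB, h.region_pts hB'] at hx
  have h1 := hx.1.1
  have h2 := hx.2.1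
  rw [mem_Icc] at h1 h2
  rcases h.precedes_or hB hB' hne with (⟨-, hc⟩ | hp) | ⟨-, hc⟩ | hp
  · exact hc.ne he
  · linarith
  · exact hc.ne he.symm
  · linarith

end IsTiling

/-! ### Assembling the blocks of a string -/

namespace Block

theorem width_config (k : Block) : k.config.width = k.width := by
  cases k <;> rfl

theorem mem_points_config {k : Block} {p : ℝ × ℝ} (a : ℝ) :
    p ∈ k.config.points ↔ (a + p.1, p.2) ∈ k.pts a := by
  obtain ⟨x, y⟩ := p
  -- Reflection produces the coordinates 36/49 - 12/49 and 36/49 - 30/49, the sites use 24/49 and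
  -- 6/49.
  have h1 : a + x = a + 24 / 49 ↔ 36 / 49 - 12 / 49 = x := by grind
  have h2 : a + x = a + 6 / 49 ↔ 36 / 49 - 30 / 49 = x := by grind
  rw [mem_pts]
  cases k <;> simp only [config, R3, R5, Config.reflect, sites, profileSite, List.mem_cons,
    List.not_mem_nil, or_false, Finset.mem_insert, Finset.mem_singleton, Finset.image_insert,
    Finset.image_singleton, exists_eq_or_imp, exists_eq_left, Prod.mk.injEq, add_right_inj] <;>
    grind

/-- The blocks of a 0-1 string. -/
def ofString (S : List Bool) : List Block :=
  S.flatMap fun b => if b then [three, threeMirror, five] else [three, threeMirror]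

theorem blocks_eq_map (S : List Bool) : blocks S = (ofString S).map config := by
  rw [blocks, ofString, List.map_flatMap]
  congr 1
  ext1 b
  cases b <;> rfl

theorem isChain_ofString (S : List Bool) : (ofString S).IsChain Compatible := by
  -- The induction also has to know that a nonempty block list starts with `three`, which may follow
  -- both `threeMirror` and `five`.
  have key : ∀ S, (ofString S).IsChain Compatible ∧ ∀ k ∈ (ofString S).head?, k = three := by
    intro S
    induction S with
    | nil => simp [ofString]
    | cons b S ih =>
      obtain ⟨ih, hhead⟩ := ih
      cases b <;> simp only [ofString, List.flatMap_cons, Bool.false_eq_true, if_true, if_false,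
        List.cons_append, List.nil_append, List.head?_cons, Option.mem_def, Option.some.injEq,
        forall_eq'] at * <;>
      refine ⟨?_, trivial⟩ <;> cases hL : List.flatMap (fun b : Bool =>
        if b = true then [three, threeMirror, five] else [three, threeMirror]) S with
      | nil => simp [Compatible]
      | cons k L =>
        rw [hL] at ih hhead
        have := hhead k rfl
        subst this
        simp [Compatible, ih]
  exact (key S).1

/-- Place blocks side by side, starting at the first coordinate `a`. -/
def place : ℝ → List Block → List (ℝ × Block)
  | _, [] => []
  | a, k :: L => (a, k) :: place (a + k.width) L

theorem le_of_mem_place {L : List Block} {a : ℝ} {B : ℝ × Block} (hB : B ∈ place a L) :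
    a ≤ B.1 := by
  induction L generalizing a with
  | nil => simp [place] at hB
  | cons k L ih =>
    rcases List.mem_cons.1 hB with rfl | hB
    · rfl
    · linarith [ih hB, k.width_pos]

theorem width_ge (k : Block) : 36 / 49 ≤ k.width := by
  cases k <;> norm_num [width]

theorem pairwise_place {L : List Block} (hL : L.IsChain Compatible) (a : ℝ) :
    (place a L).Pairwise Precedes := by
  induction L generalizing a with
  | nil => exact List.Pairwise.nil
  | cons k L ih =>
    refine List.pairwise_cons.2 ⟨fun B hB => ?_, ih hL.tail _⟩
    cases L with
    | nil => simp [place] at hB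
    | cons l L =>
      rcases List.mem_cons.1 hB with rfl | hB
      · exact Or.inl ⟨rfl, (List.isChain_cons_cons.1 hL).1⟩
      -- The block l lies in between and is at least 36/49 wide.
      · exact Or.inr (by linarith [le_of_mem_place hB, l.width_ge])

/-- The configuration that consists of the given blocks. -/
def assemble (L : List Block) : Config := Config.concat (L.map config)

theorem assemble_cons (k : Block) (L : List Block) :
    assemble (k :: L) = Config.append k.config (assemble L) := rfl

theorem width_assemble_cons (k : Block) (L : List Block) :
    (assemble (k :: L)).width = k.width + (assemble L).width := by
  rw [assemble_cons, Config.append, width_config]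

theorem width_assemble_nonneg (L : List Block) : 0 ≤ (assemble L).width := by
  induction L with
  | nil => exact le_rfl
  | cons k L ih =>
    rw [width_assemble_cons]
    linarith [k.width_pos]

theorem mem_points_append {A C : Config} {p : ℝ × ℝ} :
    p ∈ (A.append C).points ↔ p ∈ A.points ∨ (p.1 - A.width, p.2) ∈ C.points := by
  simp only [Config.append, Finset.mem_union, Finset.mem_image]
  refine or_congr_right ⟨?_, fun h => ⟨_, h, by simp⟩⟩
  rintro ⟨q, hq, rfl⟩
  simpa using hq

theorem mem_points_assemble {L : List Block} {p : ℝ × ℝ} (a : ℝ) :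
    p ∈ (assemble L).points ↔ ∃ B ∈ place a L, (a + p.1, p.2) ∈ B.2.pts B.1 := by
  induction L generalizing a p with
  | nil => simp [place, assemble, Config.concat, Config.empty]
  | cons k L ih =>
    rw [assemble_cons, mem_points_append, mem_points_config a, ih (a + k.width), place]
    simp [width_config]

theorem mem_slab_of_mem_place {L : List Block} {a : ℝ} {B : ℝ × Block} (hB : B ∈ place a L) :
    B.1 + B.2.width ≤ a + (assemble L).width := by
  induction L generalizing a with
  | nil => simp [place] at hB
  | cons k L ih =>
    rw [width_assemble_cons]
    rcases List.mem_cons.1 hB with rfl | hB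
    · linarith [width_assemble_nonneg L]
    · linarith [ih hB]

theorem exists_mem_place {L : List Block} (hL : L ≠ []) {a x : ℝ} (h1 : a ≤ x)
    (h2 : x ≤ a + (assemble L).width) : ∃ B ∈ place a L, B.1 ≤ x ∧ x ≤ B.1 + B.2.width := by
  induction L generalizing a with
  | nil => exact absurd rfl hL
  | cons k L ih =>
    rw [width_assemble_cons] at h2
    by_cases hx : x ≤ a + k.width
    · exact ⟨_, List.mem_cons_self, h1, hx⟩
    · have hL' : L ≠ [] := by
        rintro rfl
        have : (assemble []).width = 0 := rfl
        linarith
      obtain ⟨B, hB, h⟩ := ih hL' (not_le.1 hx).le (by linarith)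
      exact ⟨B, List.mem_cons_of_mem _ hB, h⟩

theorem isTiling_assemble {L : List Block} (hL : L.IsChain Compatible) :
    IsTiling (assemble L) (place 0 L) where
  mem_points {p} := by simpa using mem_points_assemble (L := L) (p := p) 0
  pairwise := pairwise_place hL 0
  slab_subset B hB := by
    refine prod_mono (Icc_subset_Icc (le_of_mem_place hB) ?_) subset_rfl
    simpa using mem_slab_of_mem_place hB
  cover hne z hz := by
    -- The empty list must be excluded: its rectangle is the segment {0} × [0, 1], which no slab
    -- covers.
    have hL' : L ≠ [] := by
      rintro rfl
      simp [assemble, Config.concat, Config.empty] at hne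
    obtain ⟨B, hB, h⟩ := exists_mem_place hL' hz.1.1 (by simpa using hz.1.2)
    exact ⟨B, hB, h, hz.2⟩

end Block

open Block

theorem encode_eq_assemble (S : List Bool) : encode S = assemble (ofString S) := by
  rw [encode, blocks_eq_map, assemble]

theorem isTiling_encode (S : List Bool) : IsTiling (encode S) (place 0 (ofString S)) := by
  rw [encode_eq_assemble]
  exact isTiling_assemble (isChain_ofString S)

theorem IsTiling.points_subset {C : Config} {D : List (ℝ × Block)} (h : IsTiling C D) :
    (C.points : Set (ℝ × ℝ)) ⊆ C.rect := by
  intro p hp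
  obtain ⟨B, hB, s, hs, rfl⟩ := h.exists_site hp
  have := Block.pt_mem hs
  exact h.slab_subset B hB ⟨⟨by linarith [this.1.1], by linarith [this.1.2]⟩,
    by linarith [this.2.1], by linarith [this.2.2]⟩

/-! ### Recovering the string -/

theorem pos_of_mem_points_assemble {L : List Block} {p : ℝ × ℝ}
    (hp : p ∈ (assemble L).points) : 0 < p.1 := by
  obtain ⟨B, hB, hp⟩ := (mem_points_assemble 0).1 hp
  obtain ⟨s, hs, he⟩ := Block.mem_pts.1 hp
  have h1 := (Block.pt_mem hs).1.1
  have h2 := le_of_mem_place hB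
  rw [he] at h1
  dsimp only at h1
  linarith

theorem le_of_mem_points_config {k : Block} {p : ℝ × ℝ} (hp : p ∈ k.config.points) :
    p.1 ≤ k.width := by
  obtain ⟨s, hs, he⟩ := Block.mem_pts.1 ((mem_points_config 0).1 hp)
  have h1 := (Block.pt_mem hs).1.2
  rw [he] at h1
  dsimp only at h1
  linarith

/-- The points of the tail are those strictly to the right of the first block, whose own points do
not pass its right boundary. -/
theorem assemble_cons_injective {k : Block} {L L' : List Block}
    (h : assemble (k :: L) = assemble (k :: L')) : assemble L = assemble L' := by
  have hw := congrArg Config.width h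
  rw [width_assemble_cons, width_assemble_cons, add_right_inj] at hw
  have hmem : ∀ L : List Block, ∀ p : ℝ × ℝ, p ∈ (assemble L).points ↔
      0 < p.1 ∧ (p.1 + k.width, p.2) ∈ (assemble (k :: L)).points := by
    intro L p
    rw [assemble_cons, mem_points_append, width_config]
    simp only [add_sub_cancel_right]
    refine ⟨fun hp => ⟨pos_of_mem_points_assemble hp, Or.inr hp⟩, ?_⟩
    rintro ⟨hp, hk | hp'⟩
    · have := le_of_mem_points_config hk
      dsimp only at this
      linarith
    · exact hp'
  have hpts : (assemble L).points = (assemble L').points := by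
    ext p
    rw [hmem L, hmem L', h]
  exact Config.mk.injEq .. ▸ ⟨hw, hpts⟩

theorem ofString_cons (b : Bool) (S : List Bool) : ofString (b :: S) =
    three :: threeMirror :: ((if b then [five] else []) ++ ofString S) := by
  cases b <;> rfl

/-- The first three points of `R5` are those of `R3`, so the test point is (48/49, 3/14). After
`three`, `threeMirror` it would have to sit at 12/49 in the mirrored block, whose points are at 6/49
and 24/49. -/
theorem assemble_five_ne (L : List Block) (S : List Bool) :
    assemble (five :: L) ≠ assemble (ofString S) := by
  intro h
  cases S with
  | nil =>
    have hw := congrArg Config.width h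
    rw [width_assemble_cons] at hw
    have h0 : (assemble (ofString [])).width = 0 := rfl
    linarith [width_assemble_nonneg L, five.width_pos]
  | cons b S =>
    have h1 : ((48 / 49, 3 / 14) : ℝ × ℝ) ∈ (assemble (five :: L)).points := by
      rw [assemble_cons, mem_points_append]
      left
      simp [config, R5]
    rw [h, ofString_cons, assemble_cons, mem_points_append, assemble_cons, mem_points_append,
      width_config, width_config] at h1
    rcases h1 with h1 | h1 | h1
    · have := le_of_mem_points_config h1
      norm_num [width] at this
    · norm_num [config, R3, Config.reflect, width] at h1
    · have := pos_of_mem_points_assemble h1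
      norm_num [width] at this

theorem width_assemble_ofString_cons (b : Bool) (S : List Bool) :
    1 ≤ (assemble (ofString (b :: S))).width := by
  rw [ofString_cons, width_assemble_cons, width_assemble_cons]
  have := width_assemble_nonneg ((if b then [five] else []) ++ ofString S)
  norm_num [width]
  linarith

theorem encode_injective : Function.Injective encode := by
  intro S
  induction S with
  | nil =>
    intro S' h
    cases S' with
    | nil => rfl
    | cons b S' =>
      have h1 := width_assemble_ofString_cons b S'
      rw [← encode_eq_assemble, ← h] at h1
      exact absurd h1 (by norm_num [encode, blocks, Config.concat, Config.empty])
  | cons b S ih =>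
    intro S' h
    cases S' with
    | nil =>
      have h1 := width_assemble_ofString_cons b S
      rw [← encode_eq_assemble, h] at h1
      exact absurd h1 (by norm_num [encode, blocks, Config.concat, Config.empty])
    | cons b' S' =>
      rw [encode_eq_assemble, encode_eq_assemble, ofString_cons, ofString_cons] at h
      have h' := assemble_cons_injective (assemble_cons_injective h)
      have hS : ∀ {S'}, assemble (ofString S) = assemble (ofString S') → S = S' := fun h =>
        ih (by rw [encode_eq_assemble, encode_eq_assemble, h])
      cases b <;> cases b' <;> simp only [Bool.false_eq_true, if_true, if_false, List.nil_append,
        List.cons_append] at h'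
      · rw [hS h']
      · exact absurd h'.symm (assemble_five_ne _ _)
      · exact absurd h' (assemble_five_ne _ _)
      · rw [hS (assemble_cons_injective h')]

end ManhattanVoronoi

end

theorem theorem3p5 :
    Function.Injective ManhattanVoronoi.encode ∧
    ∀ S : List Bool,
      ((ManhattanVoronoi.encode S).points : Set (ℝ × ℝ)) ⊆ (ManhattanVoronoi.encode S).rect ∧
      (S ≠ [] → 1 ≤ (ManhattanVoronoi.encode S).width ∧
        (ManhattanVoronoi.encode S).points.Nonempty) ∧
      (ManhattanVoronoi.encode S).Balanced ∧
      (ManhattanVoronoi.encode S).NonRepetitive ∧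
      (ManhattanVoronoi.encode S).NoRectangularCell := by
  refine ⟨ManhattanVoronoi.encode_injective, fun S => ?_⟩
  have h := ManhattanVoronoi.isTiling_encode S
  refine ⟨h.points_subset, fun hS => ?_, h.balanced, h.nonRepetitive, h.noRectangularCell⟩
  cases S with
  | nil => exact absurd rfl hS
  | cons b S =>
    constructor
    · rw [ManhattanVoronoi.encode_eq_assemble]
      exact ManhattanVoronoi.width_assemble_ofString_cons b S
    · obtain ⟨p, hp⟩ := ManhattanVoronoi.Block.three.pts_nonempty 0
      refine ⟨p, h.mem_points.2 ⟨(0, .three), ?_, hp⟩⟩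
      rw [ManhattanVoronoi.ofString_cons]
      exact List.mem_cons_self
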